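/- Let $\Lambda\in\mathbb{N}$. An edge-colored graph is a finite simple graph $G=(V,E)$ with a map $f:E\to[\Lambda]$; isomorphisms of edge-colored graphs are graph isomorphisms that preserve the color of every edge, and a subgraph of $G$ carries the restriction of $f$. For $v\in V$ let $G_v$ be the edge-colored graph obtained from $G$ by deleting $v$ and all edges incident with $v$. Let $G$ and $H$ be edge-colored graphs with colors in $[\Lambda]$ and the same finite vertex set $V$ such that $G_v\cong H_v$ for every $v\in V$ (that is, $G$ and $H$ are reconstructions of each other). Then: 1. For every function $m$ that assigns a natural number $m(\tau)$ to each isomorphism type $\tau$ of finite edge-colored graphs with colors in $[\Lambda]$, the number of disconnected spanning subgraphs (with vertex set $V$) that have exactly $m(\tau)$ connected components of type $\tau$ for every $\tau$ is the same for $G$ and for $H$. 2. If $|V|\neq 2$, then for every $(a_1,\dots,a_\Lambda)\in\mathbb{N}^\Lambda$, the number of connected spanning subgraphs that have exactly $a_c$ edges of color $c$ for every $c\in[\Lambda]$ is the same for $G$ and for $H$. -/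

import Mathlib

/-- An edge-colored simple graph on the vertex set `V` with color set `{0, …, Λ - 1}`. -/
structure ColoredGraph (V : Type*) (Λ : ℕ) where
  /-- The underlying simple graph. -/
  graph : SimpleGraph V
  /-- The color of each edge. -/
  color : graph.edgeSet → Fin Λ

namespace ColoredGraph

/-- Two colored graphs are isomorphic if there is an isomorphism of the underlying graphs that
preserves the color of every edge. -/
def IsIsomorphic {V W : Type*} {Λ : ℕ} (G : ColoredGraph V Λ) (H : ColoredGraph W Λ) : Prop :=
  ∃ φ : G.graph ≃g H.graph, ∀ e : G.graph.edgeSet, H.color (φ.mapEdgeSet e) = G.color e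

theorem IsIsomorphic.refl {V : Type*} {Λ : ℕ} (G : ColoredGraph V Λ) : G.IsIsomorphic G := by
  refine ⟨SimpleGraph.Iso.refl, ?_⟩
  rintro ⟨e, he⟩
  induction e using Sym2.ind
  rfl

theorem IsIsomorphic.symm {V W : Type*} {Λ : ℕ} {G : ColoredGraph V Λ} {H : ColoredGraph W Λ}
    (h : G.IsIsomorphic H) : H.IsIsomorphic G := by
  obtain ⟨φ, hφ⟩ := h
  refine ⟨φ.symm, fun e => ?_⟩
  have h1 := hφ (φ.symm.mapEdgeSet e)
  have h2 : φ.mapEdgeSet (φ.symm.mapEdgeSet e) = e := φ.mapEdgeSet.apply_symm_apply e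
  rw [h2] at h1
  exact h1.symm

theorem IsIsomorphic.trans {V W X : Type*} {Λ : ℕ} {G : ColoredGraph V Λ} {H : ColoredGraph W Λ}
    {K : ColoredGraph X Λ} (h : G.IsIsomorphic H) (h' : H.IsIsomorphic K) :
    G.IsIsomorphic K := by
  obtain ⟨φ, hφ⟩ := h
  obtain ⟨ψ, hψ⟩ := h'
  refine ⟨φ.trans ψ, fun e => ?_⟩
  rw [← hφ e, ← hψ (φ.mapEdgeSet e)]
  congr 1
  obtain ⟨e, he⟩ := e
  induction e using Sym2.ind
  rfl

/-- The relation "being isomorphic" on colored graphs with vertex sets `Fin n`, `n : ℕ`. -/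
instance isoSetoid (Λ : ℕ) : Setoid (Σ n : ℕ, ColoredGraph (Fin n) Λ) where
  r F F' := F.2.IsIsomorphic F'.2
  iseqv := ⟨fun F => IsIsomorphic.refl F.2, fun h => h.symm, fun h h' => h.trans h'⟩

/-- Isomorphism types of finite colored graphs; each one is represented by a colored graph
with vertex set `Fin n` for some `n`. -/
def IsoType (Λ : ℕ) : Type := Quotient (isoSetoid Λ)

/-- The isomorphism type of a colored graph on `Fin n`. -/
def isoType {n Λ : ℕ} (F : ColoredGraph (Fin n) Λ) : IsoType Λ :=
  Quotient.mk (isoSetoid Λ) ⟨n, F⟩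

/-- The colored subgraph induced on a set `s` of vertices, with the restricted coloring. -/
def induce {V : Type*} {Λ : ℕ} (G : ColoredGraph V Λ) (s : Set V) : ColoredGraph s Λ where
  graph := G.graph.induce s
  color e := G.color ((SimpleGraph.Embedding.induce s).mapEdgeSet e)

/-- The vertex-deleted colored subgraph. -/
def deleteVertex {V : Type*} {Λ : ℕ} (G : ColoredGraph V Λ) (v : V) :
    ColoredGraph ({v}ᶜ : Set V) Λ :=
  G.induce {v}ᶜ

/-- `H` is a reconstruction of `G`: both have the same vertex set, and for every vertex `v` the
vertex-deleted colored graphs are isomorphic. -/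
def IsReconstruction {V : Type*} {Λ : ℕ} (G H : ColoredGraph V Λ) : Prop :=
  ∀ v : V, (G.deleteVertex v).IsIsomorphic (H.deleteVertex v)

/-- `K` is a spanning subgraph of `G`: it has the same vertices, its edges are edges of `G`, and
its edges have the same colors as in `G`. -/
def IsSpanningSubgraph {V : Type*} {Λ : ℕ} (K G : ColoredGraph V Λ) : Prop :=
  ∃ h : K.graph ≤ G.graph, ∀ e : K.graph.edgeSet,
    K.color e = G.color ⟨e.1, SimpleGraph.edgeSet_mono h e.2⟩

/-- The number of connected components of `K` that are isomorphic, as colored graphs, to `F`. -/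
noncomputable def numComponents {V W : Type*} {Λ : ℕ} (K : ColoredGraph V Λ)
    (F : ColoredGraph W Λ) : ℕ :=
  {C : K.graph.ConnectedComponent | (K.induce C.supp).IsIsomorphic F}.ncard

/-- The number of edges of `K` of color `c`. -/
noncomputable def numEdges {V : Type*} {Λ : ℕ} (K : ColoredGraph V Λ) (c : Fin Λ) : ℕ :=
  {e : K.graph.edgeSet | K.color e = c}.ncard

/-- The number of disconnected spanning subgraphs of `G` that have, for every isomorphism type
`τ` of finite colored graphs, exactly `m τ` components of type `τ`. -/
noncomputable def numDisconnectedSpanning {V : Type*} {Λ : ℕ} (G : ColoredGraph V Λ)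
    (m : IsoType Λ → ℕ) : ℕ :=
  {K : ColoredGraph V Λ | K.IsSpanningSubgraph G ∧ ¬ K.graph.Connected ∧
    ∀ (n : ℕ) (F : ColoredGraph (Fin n) Λ), K.numComponents F = m F.isoType}.ncard

/-- The number of connected spanning subgraphs of `G` that have, for every color `c`, exactly
`a c` edges of color `c`. -/
noncomputable def numConnectedSpanning {V : Type*} {Λ : ℕ} (G : ColoredGraph V Λ)
    (a : Fin Λ → ℕ) : ℕ :=
  {K : ColoredGraph V Λ | K.IsSpanningSubgraph G ∧ K.graph.Connected ∧
    ∀ c : Fin Λ, K.numEdges c = a c}.ncard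

end ColoredGraph

section RelationalStructures

variable {ι X V : Type*}

/-- The maps `X → V` that preserve all relations of the family `R`. -/
def relHoms (R : ι → X → X → Prop) (A : ι → V → V → Prop) : Set (X → V) :=
  {f | ∀ i x y, R i x y → A i (f x) (f y)}

/-- Two families of relations on `V` have the same deck if for every vertex `v` they become
isomorphic, by a permutation fixing `v`, after the deletion of `v`. -/
def SameDeck (A B : ι → V → V → Prop) : Prop :=
  ∀ v, ∃ ψ : Equiv.Perm V, ψ v = v ∧
    ∀ i x y, x ≠ v → y ≠ v → (A i x y ↔ B i (ψ x) (ψ y))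

theorem SameDeck.ncard_relHoms_avoiding {A B : ι → V → V → Prop} (h : SameDeck A B)
    (R : ι → X → X → Prop) (j : ℕ) (v : V) :
    {f ∈ relHoms R A | (Set.range f).ncard = j ∧ v ∉ Set.range f}.ncard =
      {f ∈ relHoms R B | (Set.range f).ncard = j ∧ v ∉ Set.range f}.ncard := by
  obtain ⟨ψ, hv, hψ⟩ := h v
  refine Nat.card_congr (Equiv.subtypeEquiv (Equiv.arrowCongr (Equiv.refl X) ψ) fun f => ?_)
  have hr : Set.range (Equiv.arrowCongr (Equiv.refl X) ψ f) = ψ '' Set.range f := by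
    rw [← Set.range_comp]; rfl
  have hm : v ∈ ψ '' Set.range f ↔ v ∈ Set.range f := by
    conv_lhs => rw [← hv]
    exact ψ.injective.mem_set_image
  change (f ∈ relHoms R A ∧ _ ∧ _) ↔ (_ ∈ relHoms R B ∧ _ ∧ _)
  rw [hr, hm, Set.ncard_image_of_injective _ ψ.injective]
  refine and_congr_left fun hf => ?_
  have hne : ∀ x, f x ≠ v := fun x hx => hf.2 ⟨x, hx⟩
  exact forall_congr' fun i => forall_congr' fun x => forall_congr' fun y =>
    imp_congr_right fun _ => hψ i _ _ (hne x) (hne y)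

theorem card_sub_mul_ncard_range_eq [Fintype V] [Finite X] (S : Set (X → V)) (j : ℕ) :
    (Nat.card V - j) * {f ∈ S | (Set.range f).ncard = j}.ncard =
      ∑ v : V, {f ∈ S | (Set.range f).ncard = j ∧ v ∉ Set.range f}.ncard := by
  classical
  have := Fintype.ofFinite X
  have h := Finset.sum_card_bipartiteAbove_eq_sum_card_bipartiteBelow
    (s := {f : X → V | f ∈ S ∧ (Set.range f).ncard = j}) (t := (Finset.univ : Finset V))
    (fun f v => v ∉ Set.range f)
  have h1 : ∀ f ∈ ({f : X → V | f ∈ S ∧ (Set.range f).ncard = j} : Finset (X → V)),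
      (Finset.bipartiteAbove (fun f v => v ∉ Set.range f) Finset.univ f).card =
        Nat.card V - j := by
    intro f hf
    rw [Finset.mem_filter] at hf
    rw [← hf.2.2, ← Set.ncard_compl, ← Set.ncard_coe_finset]
    congr 1
    ext v
    simp [Finset.bipartiteAbove]
  rw [Finset.sum_const_nat h1] at h
  have h2 : {f ∈ S | (Set.range f).ncard = j}.ncard =
      ({f : X → V | f ∈ S ∧ (Set.range f).ncard = j} : Finset (X → V)).card := by
    rw [← Set.ncard_coe_finset]
    simp
  rw [h2, mul_comm, h]
  refine Finset.sum_congr rfl fun v _ => ?_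
  rw [← Set.ncard_coe_finset]
  congr 1
  ext f
  simp [Finset.bipartiteBelow, and_assoc]

theorem SameDeck.ncard_relHoms_range [Finite V] [Finite X] {A B : ι → V → V → Prop}
    (h : SameDeck A B) (R : ι → X → X → Prop) {j : ℕ} (hj : j < Nat.card V) :
    {f ∈ relHoms R A | (Set.range f).ncard = j}.ncard =
      {f ∈ relHoms R B | (Set.range f).ncard = j}.ncard := by
  have := Fintype.ofFinite V
  refine Nat.eq_of_mul_eq_mul_left (Nat.sub_pos_of_lt hj) ?_
  rw [card_sub_mul_ncard_range_eq, card_sub_mul_ncard_range_eq]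
  exact Finset.sum_congr rfl fun v _ => h.ncard_relHoms_avoiding R j v

theorem ncard_range_lt_eq_sum [Finite V] [Finite X] (S : Set (X → V)) (n : ℕ) :
    {f ∈ S | (Set.range f).ncard < n}.ncard =
      ∑ j ∈ Finset.range n, {f ∈ S | (Set.range f).ncard = j}.ncard := by
  induction n with
  | zero => simp
  | succ n ih =>
    rw [Finset.sum_range_succ, ← ih, ← Set.ncard_union_eq]
    · congr 1
      ext f
      simp only [Set.mem_ofPred_eq, Set.mem_union, Nat.lt_succ_iff_lt_or_eq]
      tauto
    · rw [Set.disjoint_left]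
      rintro f ⟨_, h1⟩ ⟨_, h2⟩
      omega

theorem SameDeck.ncard_relHoms_not_surjective [Finite V] [Finite X] {A B : ι → V → V → Prop}
    (h : SameDeck A B) (R : ι → X → X → Prop) :
    {f ∈ relHoms R A | (Set.range f).ncard < Nat.card V}.ncard =
      {f ∈ relHoms R B | (Set.range f).ncard < Nat.card V}.ncard := by
  rw [ncard_range_lt_eq_sum, ncard_range_lt_eq_sum]
  exact Finset.sum_congr rfl fun j hj => h.ncard_relHoms_range R (Finset.mem_range.1 hj)

theorem SameDeck.ncard_relHoms_of_card_lt [Finite V] [Finite X] {A B : ι → V → V → Prop}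
    (h : SameDeck A B) (R : ι → X → X → Prop) (hX : Nat.card X < Nat.card V) :
    (relHoms R A).ncard = (relHoms R B).ncard := by
  have key : ∀ S : Set (X → V), {f ∈ S | (Set.range f).ncard < Nat.card V} = S := fun S =>
    Set.sep_eq_self_iff_mem_true.2 fun f _ =>
      (Finite.card_range_le f).trans_lt hX
  simpa only [key] using h.ncard_relHoms_not_surjective R

theorem ncard_relHoms_eq_mul (R : ι → X → X → Prop) (A : ι → V → V → Prop) (p : X → Prop)
    (hp : ∀ i x y, R i x y → (p x ↔ p y)) :
    (relHoms R A).ncard =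
      (relHoms (fun i (x y : {x // p x}) => R i x y) A).ncard *
        (relHoms (fun i (x y : {x // ¬ p x}) => R i x y) A).ncard := by
  classical
  rw [← Set.ncard_prod]
  refine Nat.card_congr (Equiv.subtypeEquiv (Equiv.piEquivPiSubtypeProd p fun _ => V)
    fun f => ⟨fun hf => ⟨fun i x y => hf i x y, fun i x y => hf i x y⟩, fun hf i x y hxy => ?_⟩)
  by_cases hx : p x
  · exact hf.1 i ⟨x, hx⟩ ⟨y, (hp i x y hxy).1 hx⟩ hxy
  · exact hf.2 i ⟨x, hx⟩ ⟨y, fun hy => hx ((hp i x y hxy).2 hy)⟩ hxy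

theorem SameDeck.ncard_relHoms_bijective [Finite V] {A B : ι → V → V → Prop}
    (h : SameDeck A B) (R : ι → V → V → Prop) (p : V → Prop)
    (hp : ∀ i x y, R i x y → (p x ↔ p y)) (h1 : ∃ x, p x) (h2 : ∃ x, ¬ p x) :
    {f ∈ relHoms R A | f.Bijective}.ncard = {f ∈ relHoms R B | f.Bijective}.ncard := by
  have hlt : ∀ q : V → Prop, (∃ x, ¬ q x) → Nat.card {x // q x} < Nat.card V := by
    rintro q ⟨x, hx⟩
    exact Finite.card_subtype_lt hx
  have htot : (relHoms R A).ncard = (relHoms R B).ncard := by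
    rw [ncard_relHoms_eq_mul R A p hp, ncard_relHoms_eq_mul R B p hp,
      h.ncard_relHoms_of_card_lt _ (hlt p h2),
      h.ncard_relHoms_of_card_lt _ (hlt (fun x => ¬ p x) (h1.imp fun _ hx => not_not.2 hx))]
  have key : ∀ S : Set (V → V), S.ncard =
      {f ∈ S | (Set.range f).ncard < Nat.card V}.ncard + {f ∈ S | f.Bijective}.ncard := by
    intro S
    have hb : ∀ f : V → V, f.Bijective ↔ ¬ (Set.range f).ncard < Nat.card V := by
      intro f
      rw [← Finite.surjective_iff_bijective, ← Set.range_eq_univ, not_lt]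
      refine ⟨fun hf => by rw [hf, Set.ncard_univ], fun hf => ?_⟩
      exact Set.eq_of_subset_of_ncard_le (Set.subset_univ _) (by rwa [Set.ncard_univ])
    rw [← Set.ncard_union_eq]
    · congr 1
      ext f
      simp only [Set.mem_ofPred_eq, Set.mem_union, hb]
      tauto
    · rw [Set.disjoint_left]
      rintro f ⟨_, hf⟩ ⟨_, hf'⟩
      exact (hb f).1 hf' hf
  have hA := key (relHoms R A)
  have hB := key (relHoms R B)
  have hns := h.ncard_relHoms_not_surjective R
  omega

end RelationalStructures

namespace ColoredGraph

variable {V W : Type*} {Λ : ℕ}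

/-- Two vertices are joined by an edge of color `c`. -/
def ColorAdj (G : ColoredGraph V Λ) (c : Fin Λ) (u v : V) : Prop :=
  ∃ h : G.graph.Adj u v, G.color ⟨s(u, v), h⟩ = c

theorem ColorAdj.symm {G : ColoredGraph V Λ} {c : Fin Λ} {u v : V} (h : G.ColorAdj c u v) :
    G.ColorAdj c v u := by
  obtain ⟨h, rfl⟩ := h
  exact ⟨h.symm, congrArg G.color (Subtype.ext Sym2.eq_swap)⟩

theorem ext_colorAdj {G H : ColoredGraph V Λ}
    (h : ∀ c u v, G.ColorAdj c u v ↔ H.ColorAdj c u v) : G = H := by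
  obtain ⟨g, a⟩ := G
  obtain ⟨g', b⟩ := H
  obtain rfl : g = g' := by
    ext u v
    exact ⟨fun hu => ((h _ u v).1 ⟨hu, rfl⟩).1, fun hu => ((h _ u v).2 ⟨hu, rfl⟩).1⟩
  congr 1
  funext ⟨e, he⟩
  induction e using Sym2.ind with
  | _ u v => exact ((h _ u v).1 ⟨he, rfl⟩).2.symm

instance [Finite V] : Finite (ColoredGraph V Λ) :=
  Finite.of_injective ColorAdj fun _ _ h => ext_colorAdj fun c u v => by rw [h]

theorem isSpanningSubgraph_iff {K G : ColoredGraph V Λ} :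
    K.IsSpanningSubgraph G ↔ ∀ c u v, K.ColorAdj c u v → G.ColorAdj c u v := by
  constructor
  · rintro ⟨h, hc⟩ c u v ⟨hu, rfl⟩
    exact ⟨h hu, (hc ⟨s(u, v), hu⟩).symm⟩
  · intro h
    refine ⟨fun u v hu => (h _ u v ⟨hu, rfl⟩).1, ?_⟩
    rintro ⟨e, he⟩
    induction e using Sym2.ind with
    | _ u v => exact (h _ u v ⟨he, rfl⟩).2.symm

theorem iso_colorAdj_iff {G : ColoredGraph V Λ} {H : ColoredGraph W Λ} (φ : G.graph ≃g H.graph)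
    (hφ : ∀ e : G.graph.edgeSet, H.color (φ.mapEdgeSet e) = G.color e) {c : Fin Λ} {u v : V} :
    G.ColorAdj c u v ↔ H.ColorAdj c (φ u) (φ v) := by
  constructor
  · rintro ⟨hu, rfl⟩
    exact ⟨φ.map_adj_iff.2 hu, hφ ⟨s(u, v), hu⟩⟩
  · rintro ⟨hu, rfl⟩
    have hu' : G.graph.Adj u v := φ.map_adj_iff.1 hu
    exact ⟨hu', (hφ ⟨s(u, v), hu'⟩).symm⟩

theorem isIsomorphic_iff {G : ColoredGraph V Λ} {H : ColoredGraph W Λ} :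
    G.IsIsomorphic H ↔
      ∃ φ : V ≃ W, ∀ c u v, G.ColorAdj c u v ↔ H.ColorAdj c (φ u) (φ v) := by
  constructor
  · rintro ⟨φ, hφ⟩
    exact ⟨φ.toEquiv, fun _ _ _ => iso_colorAdj_iff φ hφ⟩
  · rintro ⟨φ, hφ⟩
    refine ⟨⟨φ, fun {u v} => ⟨fun h => ((hφ _ u v).2 ⟨h, rfl⟩).1,
      fun h => ((hφ _ u v).1 ⟨h, rfl⟩).1⟩⟩, ?_⟩
    rintro ⟨e, he⟩
    induction e using Sym2.ind with
    | _ u v => exact ((hφ _ u v).1 ⟨he, rfl⟩).2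

theorem induce_colorAdj {G : ColoredGraph V Λ} {s : Set V} {c : Fin Λ} {u v : s} :
    (G.induce s).ColorAdj c u v ↔ G.ColorAdj c u v :=
  Iff.rfl

theorem IsReconstruction.sameDeck {G H : ColoredGraph V Λ} (h : G.IsReconstruction H) :
    SameDeck G.ColorAdj H.ColorAdj := by
  classical
  intro v
  obtain ⟨φ, hφ⟩ := isIsomorphic_iff.1 (h v)
  have hval : ∀ x (hx : x ≠ v), Equiv.Perm.ofSubtype (p := (· ∈ ({v}ᶜ : Set V))) φ x = φ ⟨x, hx⟩ :=
    fun x hx => Equiv.Perm.ofSubtype_apply_of_mem φ hx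
  refine ⟨Equiv.Perm.ofSubtype (p := (· ∈ ({v}ᶜ : Set V))) φ,
    Equiv.Perm.ofSubtype_apply_of_not_mem φ (by simp), fun c x y hx hy => ?_⟩
  rw [hval x hx, hval y hy]
  exact hφ c ⟨x, hx⟩ ⟨y, hy⟩

/-- The colored graph obtained by pulling back along an equivalence of vertex sets. -/
def comap (G : ColoredGraph W Λ) (σ : V ≃ W) : ColoredGraph V Λ where
  graph := G.graph.comap σ
  color e := G.color ((SimpleGraph.Iso.comap σ G.graph).mapEdgeSet e)

theorem comap_colorAdj {G : ColoredGraph W Λ} {σ : V ≃ W} {c : Fin Λ} {u v : V} :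
    (G.comap σ).ColorAdj c u v ↔ G.ColorAdj c (σ u) (σ v) :=
  Iff.rfl

theorem isIsomorphic_comap (G : ColoredGraph W Λ) (σ : V ≃ W) : (G.comap σ).IsIsomorphic G :=
  isIsomorphic_iff.2 ⟨σ, fun _ _ _ => comap_colorAdj⟩

/-- Pulling back along a permutation of the vertices, as a permutation of the colored graphs. -/
def comapEquiv (σ : Equiv.Perm V) : Equiv.Perm (ColoredGraph V Λ) where
  toFun G := G.comap σ
  invFun G := G.comap σ.symm
  left_inv G := ext_colorAdj fun c u v => by simp [comap_colorAdj]
  right_inv G := ext_colorAdj fun c u v => by simp [comap_colorAdj]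

theorem relHoms_bijective_equiv (F G : ColoredGraph V Λ) :
    Nonempty ({f ∈ relHoms F.ColorAdj G.ColorAdj | f.Bijective} ≃
      {σ : Equiv.Perm V // F.IsSpanningSubgraph (G.comap σ)}) :=
  ⟨{ toFun := fun f => ⟨Equiv.ofBijective f.1 f.2.2, isSpanningSubgraph_iff.2 f.2.1⟩
     invFun := fun σ => ⟨σ.1, isSpanningSubgraph_iff.1 σ.2, σ.1.bijective⟩
     left_inv := fun _ => rfl
     right_inv := fun _ => Subtype.ext (Equiv.ext fun _ => rfl) }⟩

theorem isSpanningSubgraph_comap {F G : ColoredGraph V Λ} (σ : Equiv.Perm V) :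
    (F.comap σ).IsSpanningSubgraph (G.comap σ) ↔ F.IsSpanningSubgraph G := by
  simp only [isSpanningSubgraph_iff, comap_colorAdj]
  exact ⟨fun h c u v => by simpa using h c (σ.symm u) (σ.symm v), fun h c u v => h c _ _⟩

theorem nonempty_spanning_prod_perm_equiv (G : ColoredGraph V Λ) {P : ColoredGraph V Λ → Prop}
    (hP : ∀ K L, K.IsIsomorphic L → P K → P L) :
    Nonempty ({K : ColoredGraph V Λ // K.IsSpanningSubgraph G ∧ P K} × Equiv.Perm V ≃
      Σ F : {F : ColoredGraph V Λ // P F},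
        {f ∈ relHoms F.1.ColorAdj G.ColorAdj | f.Bijective}) := by
  refine ⟨Equiv.trans ?_ (Equiv.sigmaCongrRight fun F =>
    (Classical.choice (relHoms_bijective_equiv F.1 G)).symm)⟩
  exact
    { toFun := fun x => ⟨⟨x.1.1.comap x.2, hP _ _ (isIsomorphic_comap _ _).symm x.1.2.2⟩,
        x.2, (isSpanningSubgraph_comap x.2).2 x.1.2.1⟩
      invFun := fun y => ⟨⟨y.1.1.comap y.2.1.symm,
        (isSpanningSubgraph_comap y.2.1).1 (by
          have h : (y.1.1.comap y.2.1.symm).comap y.2.1 = y.1.1 :=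
            (comapEquiv y.2.1).right_inv y.1.1
          rw [h]; exact y.2.2),
        hP _ _ (isIsomorphic_comap _ _).symm y.1.2⟩, y.2.1⟩
      left_inv := fun x => Prod.ext
        (Subtype.ext ((comapEquiv x.2).left_inv x.1.1)) rfl
      right_inv := fun y => by
        obtain ⟨⟨F, hF⟩, σ, hσ⟩ := y
        have h : (F.comap σ.symm).comap σ = F := (comapEquiv σ).right_inv F
        refine Sigma.ext (Subtype.ext h) ?_
        simp only
        congr! }

theorem exists_separation_of_not_connected [Nonempty V] {F : ColoredGraph V Λ}
    (hF : ¬ F.graph.Connected) : ∃ p : V → Prop,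
      (∀ c x y, F.ColorAdj c x y → (p x ↔ p y)) ∧ (∃ x, p x) ∧ ∃ x, ¬ p x := by
  have h : ¬ F.graph.Preconnected := fun h => hF ⟨h⟩
  simp only [SimpleGraph.Preconnected, not_forall] at h
  obtain ⟨u, v, huv⟩ := h
  refine ⟨F.graph.Reachable u, fun c x y hxy => ?_, ⟨u, .refl u⟩, v, huv⟩
  exact ⟨fun h => h.trans hxy.1.reachable, fun h => h.trans hxy.1.symm.reachable⟩

theorem eq_of_subsingleton [Subsingleton V] (G H : ColoredGraph V Λ) : G = H :=
  ext_colorAdj fun _ u v => iff_of_false (fun h => h.1.ne (Subsingleton.elim u v))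
    fun h => h.1.ne (Subsingleton.elim u v)

theorem IsReconstruction.ncard_disconnected_spanning [Finite V] {G H : ColoredGraph V Λ}
    (h : G.IsReconstruction H) {P : ColoredGraph V Λ → Prop}
    (hP : ∀ K L, K.IsIsomorphic L → P K → P L) (hd : ∀ K, P K → ¬ K.graph.Connected) :
    {K : ColoredGraph V Λ | K.IsSpanningSubgraph G ∧ P K}.ncard =
      {K : ColoredGraph V Λ | K.IsSpanningSubgraph H ∧ P K}.ncard := by
  classical
  cases isEmpty_or_nonempty V
  · rw [eq_of_subsingleton G H]
  have := Fintype.ofFinite {F : ColoredGraph V Λ // P F}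
  refine Nat.eq_of_mul_eq_mul_right (Nat.card_pos (α := Equiv.Perm V)) ?_
  have key : ∀ G : ColoredGraph V Λ,
      {K : ColoredGraph V Λ | K.IsSpanningSubgraph G ∧ P K}.ncard * Nat.card (Equiv.Perm V) =
        ∑ F : {F : ColoredGraph V Λ // P F},
          {f ∈ relHoms F.1.ColorAdj G.ColorAdj | f.Bijective}.ncard := fun G =>
    (Nat.card_prod _ _).symm.trans
      ((Nat.card_congr (nonempty_spanning_prod_perm_equiv G hP).some).trans Nat.card_sigma)
  rw [key, key]
  refine Finset.sum_congr rfl fun F _ => ?_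
  obtain ⟨p, hp, h1, h2⟩ := exists_separation_of_not_connected (hd F.1 F.2)
  exact h.sameDeck.ncard_relHoms_bijective _ p hp h1 h2

theorem numEdges_congr {G : ColoredGraph V Λ} {H : ColoredGraph W Λ} (h : G.IsIsomorphic H)
    (c : Fin Λ) : G.numEdges c = H.numEdges c := by
  obtain ⟨φ, hφ⟩ := h
  exact Nat.card_congr (Equiv.subtypeEquiv φ.mapEdgeSet fun e => by
    change G.color e = c ↔ H.color (φ.mapEdgeSet e) = c
    rw [hφ])

theorem numComponents_congr {X : Type*} {G : ColoredGraph V Λ} {H : ColoredGraph W Λ}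
    (h : G.IsIsomorphic H) (F : ColoredGraph X Λ) : G.numComponents F = H.numComponents F := by
  obtain ⟨φ, hφ⟩ := id h
  refine Nat.card_congr (Equiv.subtypeEquiv φ.connectedComponentEquiv fun C => ?_)
  have hC : (G.induce C.supp).IsIsomorphic (H.induce (φ.connectedComponentEquiv C).supp) :=
    isIsomorphic_iff.2 ⟨SimpleGraph.ConnectedComponent.isoEquivSupp φ C, fun c u v => by
      rw [induce_colorAdj, induce_colorAdj]
      exact iso_colorAdj_iff φ hφ⟩
  exact ⟨fun h => hC.symm.trans h, fun h => hC.trans h⟩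

theorem connected_congr {G : ColoredGraph V Λ} {H : ColoredGraph W Λ}
    (h : G.IsIsomorphic H) : G.graph.Connected ↔ H.graph.Connected :=
  h.choose.connected_iff

/-- The graph formed by the edges of color `c`. -/
def colorGraph (G : ColoredGraph V Λ) (c : Fin Λ) : SimpleGraph V where
  Adj := G.ColorAdj c
  symm := ⟨fun _ _ h => h.symm⟩
  loopless := ⟨fun _ h => h.1.ne rfl⟩

theorem numEdges_eq_ncard_edgeSet (G : ColoredGraph V Λ) (c : Fin Λ) :
    G.numEdges c = (G.colorGraph c).edgeSet.ncard := by
  rw [numEdges, ← Set.ncard_image_of_injective _ Subtype.val_injective]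
  congr 1
  ext e
  induction e using Sym2.ind with
  | _ u v =>
    constructor
    · rintro ⟨⟨e, he⟩, hc, rfl⟩
      exact ⟨he, hc⟩
    · rintro ⟨h, hc⟩
      exact ⟨⟨_, h⟩, hc, rfl⟩

theorem two_mul_numEdges [Finite V] (G : ColoredGraph V Λ) (c : Fin Λ) :
    2 * G.numEdges c = (relHoms (fun i x y => i = c ∧ x = false ∧ y = true) G.ColorAdj).ncard := by
  classical
  have := Fintype.ofFinite V
  rw [numEdges_eq_ncard_edgeSet, ← SimpleGraph.coe_edgeFinset, Set.ncard_coe_finset,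
    ← SimpleGraph.dart_card_eq_twice_card_edges, ← Nat.card_eq_fintype_card]
  refine Nat.card_congr
    { toFun := fun d => ⟨fun b => cond b d.snd d.fst, ?_⟩
      invFun := fun f => ⟨(f.1 false, f.1 true), f.2 c false true ⟨rfl, rfl, rfl⟩⟩
      left_inv := fun _ => rfl
      right_inv := fun f => Subtype.ext (funext fun b => by cases b <;> rfl) }
  rintro _ _ _ ⟨rfl, rfl, rfl⟩
  exact d.adj

theorem IsReconstruction.numEdges_eq [Finite V] {G H : ColoredGraph V Λ}
    (h : G.IsReconstruction H) (hV : 2 < Nat.card V) (c : Fin Λ) :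
    G.numEdges c = H.numEdges c := by
  refine Nat.eq_of_mul_eq_mul_left two_pos ?_
  rw [two_mul_numEdges, two_mul_numEdges]
  exact h.sameDeck.ncard_relHoms_of_card_lt _ (by simpa using hV)

/-- The spanning subgraph with a prescribed set of edges. -/
def spanning (G : ColoredGraph V Λ) (s : Set G.graph.edgeSet) : ColoredGraph V Λ where
  graph := SimpleGraph.fromEdgeSet (Subtype.val '' s)
  color e := G.color ⟨e.1, by
    obtain ⟨e, he⟩ := e
    rw [SimpleGraph.edgeSet_fromEdgeSet] at he
    obtain ⟨⟨x, -, rfl⟩, -⟩ := he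
    exact x.2⟩

theorem mem_edgeSet_spanning (G : ColoredGraph V Λ) (s : Set G.graph.edgeSet) {e : Sym2 V} :
    e ∈ (G.spanning s).graph.edgeSet ↔ ∃ h : e ∈ G.graph.edgeSet, ⟨e, h⟩ ∈ s := by
  have h : ∀ h : e ∈ G.graph.edgeSet, ¬ e.IsDiag := fun h => G.graph.not_isDiag_of_mem_edgeSet h
  simp only [spanning, SimpleGraph.edgeSet_fromEdgeSet]
  constructor
  · rintro ⟨⟨x, hx, rfl⟩, -⟩
    exact ⟨x.2, hx⟩
  · rintro ⟨h1, h2⟩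
    exact ⟨⟨_, h2, rfl⟩, h h1⟩

theorem spanning_isSpanningSubgraph (G : ColoredGraph V Λ) (s : Set G.graph.edgeSet) :
    (G.spanning s).IsSpanningSubgraph G :=
  ⟨SimpleGraph.edgeSet_subset_edgeSet.1 fun _ he => ((mem_edgeSet_spanning G s).1 he).1,
    fun _ => rfl⟩

theorem numEdges_spanning (G : ColoredGraph V Λ) (s : Set G.graph.edgeSet) (c : Fin Λ) :
    (G.spanning s).numEdges c = {e ∈ s | G.color e = c}.ncard :=
  Nat.card_congr
    { toFun := fun e => ⟨⟨e.1.1, ((mem_edgeSet_spanning G s).1 e.1.2).1⟩,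
        ((mem_edgeSet_spanning G s).1 e.1.2).2, e.2⟩
      invFun := fun e => ⟨⟨e.1.1, (mem_edgeSet_spanning G s).2 ⟨e.1.2, e.2.1⟩⟩, e.2.2⟩
      left_inv := fun _ => rfl
      right_inv := fun _ => rfl }

/-- Spanning subgraphs correspond to sets of edges. -/
def spanningEquiv (G : ColoredGraph V Λ) :
    Set G.graph.edgeSet ≃ {K : ColoredGraph V Λ // K.IsSpanningSubgraph G} where
  toFun s := ⟨G.spanning s, G.spanning_isSpanningSubgraph s⟩
  invFun K := {e | e.1 ∈ K.1.graph.edgeSet}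
  left_inv s := by
    ext e
    change e.1 ∈ (G.spanning s).graph.edgeSet ↔ _
    rw [mem_edgeSet_spanning]
    exact ⟨fun h => h.2, fun h => ⟨e.2, h⟩⟩
  right_inv K := by
    obtain ⟨⟨g, k⟩, h, hc⟩ := K
    refine Subtype.ext (ext_colorAdj fun c u v => ?_)
    have hm := mem_edgeSet_spanning G {e | e.1 ∈ g.edgeSet} (e := s(u, v))
    constructor
    · rintro ⟨h1, h2⟩
      obtain ⟨h3, h4⟩ := hm.1 h1
      exact ⟨h4, (hc ⟨_, h4⟩).trans h2⟩
    · rintro ⟨h1, h2⟩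
      exact ⟨hm.2 ⟨h h1, h1⟩, (hc ⟨_, h1⟩).symm.trans h2⟩

theorem ncard_spanning_eq_ncard_edge_sets (G : ColoredGraph V Λ) (a : Fin Λ → ℕ) :
    {K : ColoredGraph V Λ | K.IsSpanningSubgraph G ∧ ∀ c, K.numEdges c = a c}.ncard =
      {s : Set G.graph.edgeSet | ∀ c, {e ∈ s | G.color e = c}.ncard = a c}.ncard := by
  refine Nat.card_congr (Equiv.trans (Equiv.subtypeSubtypeEquivSubtypeInter
    (fun K : ColoredGraph V Λ => K.IsSpanningSubgraph G)
    (fun K => ∀ c, K.numEdges c = a c)).symm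
    (Equiv.subtypeEquiv G.spanningEquiv fun s => ?_).symm)
  exact forall_congr' fun c => by
    change _ ↔ (G.spanning s).numEdges c = a c
    rw [numEdges_spanning]

theorem ncard_spanning_eq [Finite V] {G H : ColoredGraph V Λ}
    (h : ∀ c, G.numEdges c = H.numEdges c) (a : Fin Λ → ℕ) :
    {K : ColoredGraph V Λ | K.IsSpanningSubgraph G ∧ ∀ c, K.numEdges c = a c}.ncard =
      {K : ColoredGraph V Λ | K.IsSpanningSubgraph H ∧ ∀ c, K.numEdges c = a c}.ncard := by
  have hc : ∀ c, Nonempty ({e // G.color e = c} ≃ {e // H.color e = c}) := fun c =>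
    Finite.card_eq.1 (h c)
  let ε : G.graph.edgeSet ≃ H.graph.edgeSet :=
    Equiv.ofFiberEquiv (f := G.color) (g := H.color) fun c => (hc c).some
  have hε : ∀ e, H.color (ε e) = G.color e := fun e => Equiv.ofFiberEquiv_map _ e
  rw [ncard_spanning_eq_ncard_edge_sets, ncard_spanning_eq_ncard_edge_sets]
  refine Nat.card_congr (Equiv.subtypeEquiv (Equiv.Set.congr ε) fun s =>
    forall_congr' fun c => ?_)
  have : {e ∈ Equiv.Set.congr ε s | H.color e = c} = ε '' {e ∈ s | G.color e = c} := by
    ext e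
    obtain ⟨e, rfl⟩ := ε.surjective e
    simp [hε, Equiv.Set.congr]
  rw [this, Set.ncard_image_of_injective _ ε.injective]

theorem ncard_spanning_eq_add [Finite V] (G : ColoredGraph V Λ) (a : Fin Λ → ℕ) :
    {K : ColoredGraph V Λ | K.IsSpanningSubgraph G ∧ ∀ c, K.numEdges c = a c}.ncard =
      G.numConnectedSpanning a + {K : ColoredGraph V Λ | K.IsSpanningSubgraph G ∧
        ¬ K.graph.Connected ∧ ∀ c, K.numEdges c = a c}.ncard := by
  rw [numConnectedSpanning, ← Set.ncard_union_eq]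
  · congr 1
    ext K
    simp only [Set.mem_ofPred_eq, Set.mem_union]
    tauto
  · rw [Set.disjoint_left]
    rintro K ⟨_, h1, _⟩ ⟨_, h2, _⟩
    exact h2 h1

end ColoredGraph

theorem mainTheorem3 {V : Type*} [Finite V] (Λ : ℕ) (G H : ColoredGraph V Λ)
    (hGH : G.IsReconstruction H) :
    (∀ m : ColoredGraph.IsoType Λ → ℕ,
      G.numDisconnectedSpanning m = H.numDisconnectedSpanning m) ∧
    (Nat.card V ≠ 2 → ∀ a : Fin Λ → ℕ,
      G.numConnectedSpanning a = H.numConnectedSpanning a) := by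
  refine ⟨fun m => hGH.ncard_disconnected_spanning (fun K L hKL hK => ?_) fun K hK => hK.1,
    fun hV a => ?_⟩
  · refine ⟨fun hL => hK.1 ((ColoredGraph.connected_congr hKL).2 hL), fun n F => ?_⟩
    rw [← ColoredGraph.numComponents_congr hKL, hK.2]
  · rcases Nat.lt_or_ge 2 (Nat.card V) with h2 | h2
    · have hd := hGH.ncard_disconnected_spanning
        (P := fun K => ¬ K.graph.Connected ∧ ∀ c, K.numEdges c = a c)
        (fun K L hKL hK => ⟨fun hL => hK.1 ((ColoredGraph.connected_congr hKL).2 hL),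
          fun c => by rw [← ColoredGraph.numEdges_congr hKL, hK.2]⟩) fun K hK => hK.1
      have ht := ColoredGraph.ncard_spanning_eq (hGH.numEdges_eq h2) a
      rw [ColoredGraph.ncard_spanning_eq_add, ColoredGraph.ncard_spanning_eq_add] at ht
      omega
    · have : Subsingleton V := Finite.card_le_one_iff_subsingleton.1 (by omega)
      rw [ColoredGraph.eq_of_subsingleton G H]
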